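/- Let $S\subseteq\mathbb{R}^2$ be a Lebesgue measurable set whose Lebesgue measure $|S|$ satisfies $0<|S|<\infty$, and let $X,Y$ be independent random points, each uniformly distributed on $S$. For $x\ne y$ let $l(x,y)\in[0,\infty]$ be the one-dimensional Lebesgue measure (length) of the intersection of $S$ with the doubly infinite straight line through $x$ and $y$. Then $l(X,Y)/|X-Y|$ is almost surely defined, coincides almost surely with a $[0,\infty]$-valued random variable, and $$\mathbb{E}\left(\frac{l(X,Y)}{|X-Y|}\right)\le 3 .$$ Equality holds if and only if $S$ is essentially convex, i.e. if and only if there is a set $N\subseteq\mathbb{R}^2$ of Lebesgue measure $0$ such that the symmetric difference $S\,\triangle\,N$ is convex. -/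

import Mathlib

open MeasureTheory ProbabilityTheory

/-- The Euclidean plane `ℝ²`. -/
abbrev Plane : Type := EuclideanSpace ℝ (Fin 2)

/-- `S` is essentially convex: for some Lebesgue null set `N`, the symmetric difference of `S`
and `N` is convex. -/
def EssentiallyConvex (S : Set Plane) : Prop :=
  ∃ N : Set Plane, volume N = 0 ∧ Convex ℝ (symmDiff S N)

/-- The length (one-dimensional Hausdorff measure, which on a straight line is the one-dimensional
Lebesgue measure) of the intersection of `S` with the doubly infinite line through `x` and `y`. -/
noncomputable def chordLength (S : Set Plane) (x y : Plane) : ENNReal :=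
  Measure.hausdorffMeasure 1 (S ∩ (line[ℝ, x, y] : Set Plane))

/-!
For `x ≠ y` the chord length divided by `|x - y|` is the Lebesgue measure of the set of parameters
`t ∈ ℝ` with `x + t (y - x) ∈ S` (`chordLength_div_enorm`). By Tonelli's theorem the expectation is
therefore `|S|⁻² ∫ g(t) dt`, where `g(t)` (`collinearMass`) is the measure of the pairs
`(x, y) ∈ S × S` with `x + t (y - x) ∈ S`; in particular `g ≤ |S|²`.

Permuting the three collinear points `x`, `y`, `x + t (y - x)` gives two functional equations:
`g(1 - t) = g(t)` (`collinearMass_one_sub`), and `g(t⁻¹) = t² g(t)` (`collinearMass_inv`), where the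
factor `t²` is the area distortion of a homothety of ratio `t`. It cancels the Jacobian `t⁻²` of
`t ↦ t⁻¹`, so the integrals of `g` over `t < 0`, `0 < t < 1` and `1 < t` all agree.
Hence the expectation is `3 |S|⁻² ∫₀¹ g ≤ 3`.

Equality holds iff `g(t) = |S|²` for almost every `t ∈ (0, 1)`, that is, iff almost all segments
between points of `S` lie in `S` up to a null set. This is clear if `S` agrees almost everywhere
with a convex set. Conversely, it makes the set of Lebesgue density points of `S` convex
(`convex_densityPoints`): if `x`, `y` are density points and `z` is between them, then there is a
homothety centred at a point of `S` near `x` which maps almost all of `S` into `S` and a ball about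
`y` onto a neighbourhood of a ball of comparable size about `z`, so the density of the complement of
`S` at `z` is controlled by the one at `y`. By Lebesgue's density theorem the density points agree
with `S` almost everywhere.
-/

open AffineMap Set Filter Topology Metric

/-! ### Chords through two points -/

/-- Parametrizing the line through `x ≠ y` by `t ↦ x + t (y - x)`, which scales lengths by
`‖x - y‖`, turns the normalized chord length into the measure of a set of parameters. -/
theorem chordLength_div_enorm (S : Set Plane) {x y : Plane} (hxy : x ≠ y) :
    chordLength S x y / ‖x - y‖ₑ = volume {t : ℝ | lineMap x y t ∈ S} := by
  have himage : S ∩ (line[ℝ, x, y] : Set Plane) =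
      (lineMap x y : ℝ →ᵃ[ℝ] Plane) '' {t : ℝ | lineMap x y t ∈ S} := by
    ext z
    constructor
    · rintro ⟨hzS, hz⟩
      obtain ⟨t, rfl⟩ := mem_affineSpan_pair_iff_exists_lineMap_eq.1 hz
      exact ⟨t, hzS, rfl⟩
    · rintro ⟨t, ht, rfl⟩
      exact ⟨ht, AffineMap.lineMap_mem_affineSpan_pair t x y⟩
  have hpos : (nndist x y : ENNReal) ≠ 0 := by simpa using hxy
  rw [chordLength, himage, hausdorffMeasure_lineMap_image, hausdorffMeasure_real,
    ← edist_eq_enorm_sub, edist_nndist, ENNReal.smul_def, smul_eq_mul, mul_comm,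
    ENNReal.mul_div_cancel_right hpos ENNReal.coe_ne_top]

theorem measurable_lineMap_uncurry :
    Measurable fun q : (Plane × Plane) × ℝ => (lineMap q.1.1 q.1.2 q.2 : Plane) := by
  simp only [lineMap_apply_module]
  fun_prop

theorem measurableSet_lineMap_pair_mem {S : Set Plane} (hS : MeasurableSet S) (t : ℝ) :
    MeasurableSet {p : Plane × Plane | (lineMap p.1 p.2 t : Plane) ∈ S} := by
  have h : Measurable fun p : Plane × Plane => (lineMap p.1 p.2 t : Plane) := by
    simp only [lineMap_apply_module]
    fun_prop
  exact h hS

theorem measurable_lineMap_right (x : Plane) (t : ℝ) :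
    Measurable fun y : Plane => (lineMap x y t : Plane) := by
  simp only [lineMap_apply_module]
  fun_prop

/-- The homothety with centre `x` and ratio `t` carries `y` to `z = lineMap x y t`, so that
`y = lineMap x z t⁻¹`; conditions on `y` and `z` become conditions on `z` and `y`. -/
theorem homothety_image_inter (x : Plane) {t : ℝ} (ht : t ≠ 0) (A B : Set Plane) :
    homothety x t '' ({y | (lineMap x y t : Plane) ∈ A} ∩ B) =
      {z | (lineMap x z t⁻¹ : Plane) ∈ B} ∩ A := by
  have hinv : ∀ (z : Plane) {s : ℝ}, s ≠ 0 →
      (lineMap x (lineMap x z s : Plane) s⁻¹ : Plane) = z := by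
    intro z s hs
    rw [lineMap_lineMap_right, inv_mul_cancel₀ hs, lineMap_apply_one]
  ext z
  constructor
  · rintro ⟨y, ⟨hyA, hyB⟩, rfl⟩
    rw [homothety_eq_lineMap]
    refine ⟨?_, hyA⟩
    rwa [mem_ofPred_eq, hinv y ht]
  · rintro ⟨hzB, hzA⟩
    have h := hinv z (inv_ne_zero ht)
    rw [inv_inv] at h
    exact ⟨lineMap x z t⁻¹, ⟨by rwa [mem_ofPred_eq, h], hzB⟩, by rw [homothety_eq_lineMap, h]⟩

/-- Homotheties of the plane with ratio `t` scale areas by `t ^ 2`. -/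
theorem volume_homothety_image (x : Plane) (t : ℝ) (A : Set Plane) :
    volume (homothety x t '' A) = ENNReal.ofReal (t ^ 2) * volume A := by
  rw [Measure.addHaar_image_homothety, finrank_euclideanSpace_fin, abs_of_nonneg (sq_nonneg t)]

theorem ae_lineMap_notMem {N : Set Plane} (hN : volume N = 0) (x : Plane) {t : ℝ} (ht : t ≠ 0) :
    ∀ᵐ y : Plane, (lineMap x y t : Plane) ∉ N := by
  have h := volume_homothety_image x t ({y | (lineMap x y t : Plane) ∈ N} ∩ univ)
  rw [homothety_image_inter x ht N univ, inter_univ] at h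
  have h0 : volume ({z : Plane | (lineMap x z t⁻¹ : Plane) ∈ univ} ∩ N) = 0 :=
    measure_mono_null inter_subset_right hN
  rw [h0, eq_comm, mul_eq_zero] at h
  rcases h with h | h
  · exact absurd (ENNReal.ofReal_eq_zero.1 h) (not_le.2 (by positivity))
  · simpa [ae_iff] using h

theorem ae_pair_ae_lineMap_notMem {N : Set Plane} (hN : volume N = 0) :
    ∀ᵐ p : Plane × Plane, ∀ᵐ t : ℝ, (lineMap p.1 p.2 t : Plane) ∉ N := by
  have hM : MeasurableSet (toMeasurable volume N) := measurableSet_toMeasurable _ _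
  have hM0 : volume (toMeasurable volume N) = 0 := by rwa [measure_toMeasurable]
  have hmeas : MeasurableSet {q : (Plane × Plane) × ℝ |
      (lineMap q.1.1 q.1.2 q.2 : Plane) ∉ toMeasurable volume N} :=
    measurable_lineMap_uncurry hM.compl
  have key : ∀ᵐ t : ℝ, ∀ᵐ p : Plane × Plane,
      (lineMap p.1 p.2 t : Plane) ∉ toMeasurable volume N := by
    filter_upwards [Measure.ae_ne volume (0 : ℝ)] with t ht
    refine (Measure.ae_prod_iff_ae_ae (measurableSet_lineMap_pair_mem hM.compl t)).2 ?_
    exact Eventually.of_forall fun x => ae_lineMap_notMem hM0 x ht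
  filter_upwards [(Measure.ae_ae_comm (p := fun (p : Plane × Plane) (t : ℝ) =>
    (lineMap p.1 p.2 t : Plane) ∉ toMeasurable volume N) hmeas).2 key] with p hp
  filter_upwards [hp] with t ht h
  exact ht (subset_toMeasurable _ _ h)

/-- The normalized chord length depends, almost everywhere, only on the class of `S` modulo null
sets, and is the measure of a section of a set which is measurable when `S₀` is. -/
theorem chordLength_div_enorm_ae_eq {S S₀ : Set Plane} (h : S =ᵐ[volume] S₀) :
    (fun p : Plane × Plane => chordLength S p.1 p.2 / ‖p.1 - p.2‖ₑ) =ᵐ[volume]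
      fun p => volume {t : ℝ | (lineMap p.1 p.2 t : Plane) ∈ S₀} := by
  have hne : ∀ᵐ p : Plane × Plane, p.1 ≠ p.2 := by
    refine (Measure.ae_prod_iff_ae_ae
      (measurableSet_eq_fun measurable_fst measurable_snd).compl).2 ?_
    refine Eventually.of_forall fun x => ?_
    filter_upwards [Measure.ae_ne volume x] with y hy using hy.symm
  filter_upwards [hne, ae_pair_ae_lineMap_notMem (measure_symmDiff_eq_zero_iff.2 h)] with p hp hN
  rw [chordLength_div_enorm S hp]
  refine measure_congr ?_
  filter_upwards [hN] with t ht
  simp only [mem_symmDiff] at ht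
  exact propext (show (lineMap p.1 p.2 t : Plane) ∈ S ↔ (lineMap p.1 p.2 t : Plane) ∈ S₀ by tauto)

/-! ### Collinear triples in a fixed ratio -/

/-- The measure of the set of pairs `(x, y)` of points of `S` for which the point
`x + t (y - x)` of the line through them lies in `S` too. -/
noncomputable def collinearMass (S : Set Plane) (t : ℝ) : ENNReal :=
  ((volume.restrict S).prod (volume.restrict S)) {p : Plane × Plane | lineMap p.1 p.2 t ∈ S}

theorem collinearMass_le (S : Set Plane) (t : ℝ) :
    collinearMass S t ≤ volume S * volume S := by
  refine (measure_mono (subset_univ _)).trans ?_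
  rw [← univ_prod_univ, Measure.prod_prod, Measure.restrict_apply_univ]

/-- Exchange the two endpoints. -/
theorem collinearMass_one_sub {S : Set Plane} (hS : MeasurableSet S) (t : ℝ) :
    collinearMass S (1 - t) = collinearMass S t := by
  rw [collinearMass, collinearMass, ← Measure.measurePreserving_swap.measure_preimage
    (measurableSet_lineMap_pair_mem hS t).nullMeasurableSet]
  simp only [lineMap_apply_one_sub]
  rfl

theorem collinearMass_eq_lintegral {S : Set Plane} (hS : MeasurableSet S) (t : ℝ) :
    collinearMass S t =
      ∫⁻ x in S, volume ({y | (lineMap x y t : Plane) ∈ S} ∩ S) := by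
  rw [collinearMass, Measure.prod_apply (measurableSet_lineMap_pair_mem hS t)]
  refine lintegral_congr fun x => ?_
  exact Measure.restrict_apply (measurable_lineMap_right x t hS)

/-- Exchange the second endpoint `y` and the third point `z = x + t (y - x)`, for which
`y = x + t⁻¹ (z - x)`. -/
theorem collinearMass_inv {S : Set Plane} (hS : MeasurableSet S) {t : ℝ} (ht : t ≠ 0) :
    collinearMass S t⁻¹ = ENNReal.ofReal (t ^ 2) * collinearMass S t := by
  rw [collinearMass_eq_lintegral hS, collinearMass_eq_lintegral hS,
    ← lintegral_const_mul' _ _ ENNReal.ofReal_ne_top]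
  refine lintegral_congr fun x => ?_
  rw [← homothety_image_inter x ht S S, volume_homothety_image]

theorem measurable_collinearMass {S : Set Plane} (hS : MeasurableSet S) :
    Measurable (collinearMass S) :=
  measurable_measure_prodMk_right (measurable_lineMap_uncurry hS)

theorem setLIntegral_collinearMass_Ioi {S : Set Plane} (hS : MeasurableSet S) :
    ∫⁻ t in Ioi 1, collinearMass S t = ∫⁻ t in Ioo 0 1, collinearMass S t := by
  have himage : (fun t : ℝ => t⁻¹) '' Ioo 0 1 = Ioi 1 := by
    rw [image_inv_eq_inv, inv_Ioo_0_left one_pos, inv_one]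
  rw [← himage, lintegral_image_eq_lintegral_abs_deriv_mul measurableSet_Ioo
    (fun t ht => (hasDerivAt_inv ht.1.ne').hasDerivWithinAt) inv_injective.injOn]
  refine setLIntegral_congr_fun measurableSet_Ioo fun t ht => ?_
  have ht0 : (0 : ℝ) < t ^ 2 := pow_pos ht.1 2
  rw [collinearMass_inv hS ht.1.ne', ← mul_assoc, ← ENNReal.ofReal_mul (abs_nonneg _), abs_neg,
    abs_of_pos (inv_pos.2 ht0), inv_mul_cancel₀ ht0.ne', ENNReal.ofReal_one, one_mul]

theorem setLIntegral_collinearMass_Iio {S : Set Plane} (hS : MeasurableSet S) :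
    ∫⁻ t in Iio 0, collinearMass S t = ∫⁻ t in Ioi 1, collinearMass S t := by
  rw [← lintegral_indicator measurableSet_Iio, ← lintegral_indicator measurableSet_Ioi,
    ← lintegral_sub_left_eq_self ((Ioi 1).indicator (collinearMass S)) 1]
  refine lintegral_congr fun t => ?_
  have hiff : 1 - t ∈ Ioi (1 : ℝ) ↔ t ∈ Iio (0 : ℝ) := by simp only [mem_Ioi, mem_Iio]; grind
  by_cases ht : t ∈ Iio (0 : ℝ)
  · rw [indicator_of_mem ht, indicator_of_mem (hiff.2 ht), collinearMass_one_sub hS]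
  · rw [indicator_of_notMem ht, indicator_of_notMem (mt hiff.1 ht)]

/-- The ranges `t < 0`, `0 < t < 1`, `1 < t` say which of the three collinear points is between
the other two, and contribute equally. -/
theorem lintegral_collinearMass {S : Set Plane} (hS : MeasurableSet S) :
    ∫⁻ t, collinearMass S t = 3 * ∫⁻ t in Ioo 0 1, collinearMass S t := by
  have hunion : (Ioc 0 1 ∪ Ioi 1 : Set ℝ) = Ioi 0 := Ioc_union_Ioi_eq_Ioi zero_le_one
  have hdisj : Disjoint (Ioc 0 1) (Ioi (1 : ℝ)) :=
    disjoint_left.2 fun t h h' => not_lt.2 h.2 h'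
  rw [← lintegral_add_compl _ (measurableSet_Iic (a := (0 : ℝ))), compl_Iic, ← hunion,
    lintegral_union measurableSet_Ioi hdisj, ← restrict_Iio_eq_restrict_Iic,
    ← restrict_Ioo_eq_restrict_Ioc, setLIntegral_collinearMass_Iio hS,
    setLIntegral_collinearMass_Ioi hS]
  ring

theorem lintegral_volume_lineMap_mem {S : Set Plane} (hS : MeasurableSet S) :
    ∫⁻ p, volume {t : ℝ | (lineMap p.1 p.2 t : Plane) ∈ S}
      ∂((volume.restrict S).prod (volume.restrict S)) = ∫⁻ t, collinearMass S t := by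
  have hmeas := measurable_lineMap_uncurry hS
  exact (Measure.prod_apply (μ := (volume.restrict S).prod (volume.restrict S)) (ν := volume)
    hmeas).symm.trans (Measure.prod_apply_symm hmeas)

theorem setLIntegral_collinearMass_Ioo_le (S : Set Plane) :
    ∫⁻ t in Ioo 0 1, collinearMass S t ≤ volume S * volume S := by
  calc ∫⁻ t in Ioo 0 1, collinearMass S t ≤ ∫⁻ _ in Ioo (0 : ℝ) 1, volume S * volume S :=
        lintegral_mono fun t => collinearMass_le S t
    _ = volume S * volume S := by simp

/-- The total mass on `(0, 1)` is maximal precisely when, for almost all ratios `t`, almost all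
pairs of points of `S` have their intermediate point of ratio `t` in `S`. -/
theorem setLIntegral_collinearMass_Ioo_eq_iff {S : Set Plane} (hS : MeasurableSet S)
    (hfin : volume S ≠ ⊤) :
    ∫⁻ t in Ioo 0 1, collinearMass S t = volume S * volume S ↔
      ∀ᵐ t ∂volume.restrict (Ioo (0 : ℝ) 1), ∀ᵐ x ∂volume.restrict S,
        ∀ᵐ y ∂volume.restrict S, (lineMap x y t : Plane) ∈ S := by
  have : IsFiniteMeasure (volume.restrict S) := isFiniteMeasure_restrict.2 hfin
  have hconst : ∫⁻ _ in Ioo (0 : ℝ) 1, volume S * volume S = volume S * volume S := by simp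
  have hiff : ∀ t : ℝ, (∀ᵐ x ∂volume.restrict S, ∀ᵐ y ∂volume.restrict S,
      (lineMap x y t : Plane) ∈ S) ↔ collinearMass S t = volume S * volume S := by
    intro t
    have hmeas := measurableSet_lineMap_pair_mem hS t
    rw [← Measure.ae_prod_iff_ae_ae (p := fun p : Plane × Plane => (lineMap p.1 p.2 t : Plane) ∈ S)
      hmeas, ae_iff_measure_eq hmeas.nullMeasurableSet, ← univ_prod_univ, Measure.prod_prod,
      Measure.restrict_apply_univ, collinearMass]
  simp only [hiff]
  constructor
  · intro h
    refine ae_eq_of_ae_le_of_lintegral_le (g := fun _ => volume S * volume S)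
      (Eventually.of_forall fun t => collinearMass_le S t) ?_ aemeasurable_const ?_
    · rw [h]
      exact ENNReal.mul_ne_top hfin hfin
    · rw [h, hconst]
  · intro h
    rw [lintegral_congr_ae h, hconst]

/-! ### Density points and convexity -/

/-- The points at which `S` has Lebesgue density one, expressed by the complement having
density zero. -/
def densityPoints (S : Set Plane) : Set Plane :=
  {x | Tendsto (fun r => volume (Sᶜ ∩ closedBall x r) / volume (closedBall x r)) (𝓝[>] 0) (𝓝 0)}

/-- Lebesgue's density theorem. -/
theorem densityPoints_ae_eq {S : Set Plane} (hS : MeasurableSet S) :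
    densityPoints S =ᵐ[volume] S := by
  filter_upwards [Besicovitch.ae_tendsto_measure_inter_div_of_measurableSet volume hS.compl]
    with x hx
  refine propext (show x ∈ densityPoints S ↔ x ∈ S from ⟨fun h => ?_, fun h => ?_⟩)
  · by_contra hxS
    rw [indicator_of_mem (mem_compl hxS)] at hx
    exact zero_ne_one (tendsto_nhds_unique h hx)
  · rwa [indicator_of_notMem (notMem_compl_iff.2 h)] at hx

theorem volume_inter_pos_of_mem_densityPoints {S : Set Plane} {x : Plane}
    (hx : x ∈ densityPoints S) {U : Set Plane} (hU : U ∈ 𝓝 x) :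
    0 < volume (S ∩ U) := by
  obtain ⟨ε, hε, hεU⟩ := Metric.nhds_basis_closedBall.mem_iff.1 hU
  have hsmall : ∀ᶠ r in 𝓝[>] (0 : ℝ), r < ε :=
    mem_nhdsWithin_of_mem_nhds (Iio_mem_nhds hε)
  obtain ⟨r, hr, hrε, hr0⟩ := ((hx.eventually (Iio_mem_nhds one_pos)).and
    (hsmall.and self_mem_nhdsWithin)).exists
  have hball : closedBall x r ⊆ U := (closedBall_subset_closedBall hrε.le).trans hεU
  by_contra h0
  have h0' : volume (S ∩ closedBall x r) = 0 :=
    measure_mono_null (inter_subset_inter_right S hball) (by simpa using h0)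
  have hle : volume (closedBall x r) ≤ volume (Sᶜ ∩ closedBall x r) := by
    calc volume (closedBall x r)
        ≤ volume (S ∩ closedBall x r) + volume (Sᶜ ∩ closedBall x r) := by
          refine (measure_mono fun z hz => ?_).trans (measure_union_le _ _)
          by_cases h : z ∈ S
          exacts [Or.inl ⟨h, hz⟩, Or.inr ⟨h, hz⟩]
      _ = volume (Sᶜ ∩ closedBall x r) := by rw [h0', zero_add]
  have h1 : volume (Sᶜ ∩ closedBall x r) / volume (closedBall x r) < 1 := hr
  rw [ENNReal.div_lt_iff (Or.inl (measure_closedBall_pos _ _ hr0).ne')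
    (Or.inl measure_closedBall_lt_top.ne), one_mul] at h1
  exact not_le.2 h1 hle

/-- A pair `(x', t')` close to `(x, t)` for which almost all segments from `x'` into `S` have
their point of ratio `t'` in `S` gives a homothety with centre `x'` and ratio `t'`, which carries
the ball of radius `r` about `y` onto a neighbourhood of the ball of radius `t r / 2` about the
intermediate point, and the part of it in `S` into `S`. -/
theorem volume_compl_inter_closedBall_lineMap_le {S : Set Plane}
    (H : ∀ᵐ t ∂volume.restrict (Ioo (0 : ℝ) 1), ∀ᵐ x ∂volume.restrict S,
      ∀ᵐ y ∂volume.restrict S, (lineMap x y t : Plane) ∈ S) (hS : MeasurableSet S)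
    {x y : Plane} (hx : x ∈ densityPoints S) {t : ℝ} (ht : t ∈ Ioo (0 : ℝ) 1) {r : ℝ}
    (hr : 0 < r) :
    volume (Sᶜ ∩ closedBall (lineMap x y t) (t * r / 2)) ≤ volume (Sᶜ ∩ closedBall y r) := by
  have hnear : ∀ᶠ q : Plane × ℝ in 𝓝 (x, t),
      t * r / 2 + dist (lineMap x y t : Plane) (lineMap q.1 y q.2) < q.2 * r := by
    have hcont : Continuous fun q : Plane × ℝ =>
        q.2 * r - (t * r / 2 + dist (lineMap x y t : Plane) (lineMap q.1 y q.2)) := by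
      simp only [lineMap_apply_module]
      fun_prop
    have hpos : 0 < t * r - (t * r / 2 + dist (lineMap x y t : Plane) (lineMap x y t)) := by
      rw [dist_self]
      have := mul_pos ht.1 hr
      linarith
    filter_upwards [hcont.continuousAt.eventually (Ioi_mem_nhds hpos)] with q hq
    exact sub_pos.1 hq
  rw [nhds_prod_eq] at hnear
  obtain ⟨p, hp, p', hp', hpp'⟩ := Filter.eventually_prod_iff.1 hnear
  obtain ⟨s, hs, hs', hsH⟩ : ∃ s, s ∈ Ioo (0 : ℝ) 1 ∧ p' s ∧ ∀ᵐ x ∂volume.restrict S,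
      ∀ᵐ y ∂volume.restrict S, (lineMap x y s : Plane) ∈ S := by
    have hV : volume ({s | p' s} ∩ Ioo 0 1) ≠ 0 :=
      (Measure.measure_pos_of_mem_nhds volume (inter_mem hp' (isOpen_Ioo.mem_nhds ht))).ne'
    rw [ae_restrict_iff' measurableSet_Ioo] at H
    obtain ⟨s, hs, hsH⟩ := ((frequently_ae_mem_iff.2 hV).and_eventually H).exists
    exact ⟨s, hs.2, hs.1, hsH hs.2⟩
  obtain ⟨x', hx', hxH⟩ : ∃ x', p x' ∧ ∀ᵐ y ∂volume.restrict S, (lineMap x' y s : Plane) ∈ S := by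
    rw [ae_restrict_iff' hS] at hsH
    obtain ⟨x', hx', hxH⟩ := ((frequently_ae_mem_iff.2
      (volume_inter_pos_of_mem_densityPoints hx hp).ne').and_eventually hsH).exists
    exact ⟨x', hx'.2, hxH hx'.1⟩
  have hclose := hpp' hx' hs'
  have hsub : Sᶜ ∩ closedBall (lineMap x y t : Plane) (t * r / 2) ⊆
      homothety x' s '' ({w | (lineMap x' w s : Plane) ∈ Sᶜ} ∩ closedBall y r) := by
    rw [homothety_image_inter x' hs.1.ne']
    rintro w ⟨hwS, hw⟩
    refine ⟨?_, hwS⟩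
    have hw' : w = lineMap x' (lineMap x' w s⁻¹ : Plane) s := by
      rw [lineMap_lineMap_right, mul_inv_cancel₀ hs.1.ne', lineMap_apply_one]
    have hdist : s * dist (lineMap x' w s⁻¹ : Plane) y = dist w (lineMap x' y s) := by
      conv_rhs => rw [hw']
      rw [← homothety_eq_lineMap x' s, ← homothety_eq_lineMap x' s, dist_eq_norm, dist_eq_norm,
        ← vsub_eq_sub, ← vsub_eq_sub, ← AffineMap.linearMap_vsub, homothety_linear]
      simp [norm_smul, abs_of_pos hs.1]
    rw [mem_ofPred_eq, mem_closedBall]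
    refine le_of_mul_le_mul_left ?_ hs.1
    rw [hdist]
    exact (dist_triangle _ _ _).trans ((add_le_add_left (mem_closedBall.1 hw) _).trans hclose.le)
  have hae : ({w | (lineMap x' w s : Plane) ∈ Sᶜ} ∩ closedBall y r : Set Plane) ≤ᵐ[volume]
      (Sᶜ ∩ closedBall y r : Set Plane) := by
    rw [ae_restrict_iff' hS] at hxH
    filter_upwards [hxH] with w hw hwm
    exact ⟨fun hwS => hwm.1 (hw hwS), hwm.2⟩
  calc volume (Sᶜ ∩ closedBall (lineMap x y t) (t * r / 2))
      ≤ ENNReal.ofReal (s ^ 2) *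
          volume ({w | (lineMap x' w s : Plane) ∈ Sᶜ} ∩ closedBall y r) := by
        rw [← volume_homothety_image x' s]
        exact measure_mono hsub
    _ ≤ 1 * volume (Sᶜ ∩ closedBall y r) := by
        refine mul_le_mul' ?_ (measure_mono_ae hae)
        exact ENNReal.ofReal_le_one.2 (pow_le_one₀ hs.1.le hs.2.le)
    _ = volume (Sᶜ ∩ closedBall y r) := one_mul _

theorem convex_densityPoints {S : Set Plane} (hS : MeasurableSet S)
    (H : ∀ᵐ t ∂volume.restrict (Ioo (0 : ℝ) 1), ∀ᵐ x ∂volume.restrict S,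
      ∀ᵐ y ∂volume.restrict S, (lineMap x y t : Plane) ∈ S) :
    Convex ℝ (densityPoints S) := by
  refine convex_iff_forall_pos.2 fun x hx y hy a t ha ht hat => ?_
  have hz : a • x + t • y = lineMap x y t := by
    rw [lineMap_apply_module, ← hat, add_sub_cancel_right]
  rw [hz]
  have hc : 0 < 2 / t := by positivity
  -- The radius about `y` which controls the ball of radius `r` about the intermediate point.
  have hscale : Tendsto (fun r : ℝ => 2 / t * r) (𝓝[>] 0) (𝓝[>] 0) := by
    refine tendsto_nhdsWithin_iff.2 ⟨?_, ?_⟩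
    · have : Tendsto (fun r : ℝ => 2 / t * r) (𝓝 0) (𝓝 (2 / t * 0)) :=
        (continuous_const.mul continuous_id).tendsto 0
      rw [mul_zero] at this
      exact this.mono_left nhdsWithin_le_nhds
    · filter_upwards [self_mem_nhdsWithin] with r hr using mul_pos hc hr
  have hlim := ENNReal.Tendsto.const_mul (a := ENNReal.ofReal ((2 / t) ^ 2)) (hy.comp hscale)
    (Or.inr ENNReal.ofReal_ne_top)
  rw [mul_zero] at hlim
  refine tendsto_of_tendsto_of_tendsto_of_le_of_le' tendsto_const_nhds hlim
    (Eventually.of_forall fun _ => zero_le) ?_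
  filter_upwards [self_mem_nhdsWithin] with r hr
  have hr : 0 < r := hr
  have hle := volume_compl_inter_closedBall_lineMap_le H hS (y := y) hx
    ⟨ht, by linarith⟩ (mul_pos hc hr)
  have hrad : t * (2 / t * r) / 2 = r := by field_simp
  rw [hrad] at hle
  have hball : volume (closedBall y (2 / t * r)) =
      ENNReal.ofReal ((2 / t) ^ 2) * volume (closedBall (lineMap x y t : Plane) r) := by
    rw [Measure.addHaar_closedBall_mul _ _ hc.le hr.le, finrank_euclideanSpace_fin,
      Measure.addHaar_closedBall_center volume (lineMap x y t : Plane)]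
  have hk0 : ENNReal.ofReal ((2 / t) ^ 2) ≠ 0 := (ENNReal.ofReal_pos.2 (by positivity)).ne'
  simp only [Function.comp_apply]
  rw [hball, ← mul_div_assoc, ENNReal.mul_div_mul_left _ _ hk0 ENNReal.ofReal_ne_top]
  exact ENNReal.div_le_div_right hle _

theorem essentiallyConvex_iff_exists_ae_eq {S : Set Plane} :
    EssentiallyConvex S ↔ ∃ C : Set Plane, C =ᵐ[volume] S ∧ Convex ℝ C := by
  constructor
  · rintro ⟨N, hN, hC⟩
    refine ⟨symmDiff S N, ?_, hC⟩
    rw [← measure_symmDiff_eq_zero_iff, symmDiff_comm, symmDiff_symmDiff_cancel_left]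
    exact hN
  · rintro ⟨C, hCS, hC⟩
    refine ⟨symmDiff S C, measure_symmDiff_eq_zero_iff.2 hCS.symm, ?_⟩
    rwa [symmDiff_symmDiff_cancel_left]

theorem essentiallyConvex_congr {S S₀ : Set Plane} (h : S =ᵐ[volume] S₀) :
    EssentiallyConvex S ↔ EssentiallyConvex S₀ := by
  simp only [essentiallyConvex_iff_exists_ae_eq]
  exact exists_congr fun C => and_congr_left fun _ =>
    ⟨fun hC => hC.trans h, fun hC => hC.trans h.symm⟩

theorem essentiallyConvex_iff_ae_lineMap_mem {S : Set Plane} (hS : MeasurableSet S) :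
    EssentiallyConvex S ↔
      ∀ᵐ t ∂volume.restrict (Ioo (0 : ℝ) 1), ∀ᵐ x ∂volume.restrict S,
        ∀ᵐ y ∂volume.restrict S, (lineMap x y t : Plane) ∈ S := by
  rw [essentiallyConvex_iff_exists_ae_eq]
  constructor
  · rintro ⟨C, hCS, hC⟩
    have hmem : ∀ᵐ x ∂volume.restrict S, x ∈ C := by
      rw [ae_restrict_iff' hS]
      filter_upwards [hCS.mem_iff] with x hx using hx.2
    filter_upwards [ae_restrict_mem measurableSet_Ioo] with t ht
    filter_upwards [hmem] with x hx
    filter_upwards [hmem, ae_restrict_of_ae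
      (ae_lineMap_notMem (measure_symmDiff_eq_zero_iff.2 hCS) x ht.1.ne')] with y hy hN
    have hz : (lineMap x y t : Plane) ∈ C := hC.lineMap_mem hx hy ⟨ht.1.le, ht.2.le⟩
    by_contra hzS
    exact hN (Or.inl ⟨hz, hzS⟩)
  · exact fun H => ⟨densityPoints S, densityPoints_ae_eq hS, convex_densityPoints hS H⟩

/-! ### Independent uniform points -/

theorem map_prod_of_isUniform {Ω : Type*} [MeasurableSpace Ω] {P : Measure Ω}
    [IsProbabilityMeasure P] {S S₀ : Set Plane} (h : S =ᵐ[volume] S₀) {X Y : Ω → Plane}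
    (hX : pdf.IsUniform X S P volume) (hY : pdf.IsUniform Y S P volume)
    (hXm : AEMeasurable X P) (hYm : AEMeasurable Y P) (hXY : IndepFun X Y P) :
    P.map (fun ω => (X ω, Y ω)) = (volume S₀)⁻¹ • (volume S₀)⁻¹ •
      (volume.restrict S₀).prod (volume.restrict S₀) := by
  rw [(indepFun_iff_map_prod_eq_prod_map_map hXm hYm).1 hXY, hX, hY, ProbabilityTheory.cond,
    measure_congr h, Measure.restrict_congr_set h, Measure.prod_smul_left,
    Measure.prod_smul_right]

theorem corollary2p4 {Ω : Type*} [MeasurableSpace Ω] (P : Measure Ω) [IsProbabilityMeasure P]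
    (S : Set Plane) (hS : NullMeasurableSet S volume)
    (hS_pos : 0 < volume S) (hS_fin : volume S < ⊤)
    (X Y : Ω → Plane)
    (hX : pdf.IsUniform X S P volume) (hY : pdf.IsUniform Y S P volume)
    (hXY : IndepFun X Y P) :
    AEMeasurable (fun ω => chordLength S (X ω) (Y ω) / ‖X ω - Y ω‖ₑ) P ∧
    ∫⁻ ω, chordLength S (X ω) (Y ω) / ‖X ω - Y ω‖ₑ ∂P ≤ 3 ∧
    (∫⁻ ω, chordLength S (X ω) (Y ω) / ‖X ω - Y ω‖ₑ ∂P = 3 ↔ EssentiallyConvex S) := by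
  have hXm : AEMeasurable X P := hX.aemeasurable hS_pos.ne' hS_fin.ne
  have hYm : AEMeasurable Y P := hY.aemeasurable hS_pos.ne' hS_fin.ne
  obtain ⟨S₀, hS₀, hSS₀⟩ := hS
  have hlaw := map_prod_of_isUniform hSS₀ hX hY hXm hYm hXY
  rw [essentiallyConvex_congr hSS₀, essentiallyConvex_iff_ae_lineMap_mem hS₀]
  rw [measure_congr hSS₀] at hS_pos hS_fin
  rw [← setLIntegral_collinearMass_Ioo_eq_iff hS₀ hS_fin.ne]
  have hac : P.map (fun ω => (X ω, Y ω)) ≪ volume := by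
    rw [hlaw, Measure.prod_restrict]
    exact (Measure.absolutelyContinuous_of_le Measure.restrict_le_self).smul_left _ |>.smul_left _
  have hae := hac.ae_eq (chordLength_div_enorm_ae_eq hSS₀)
  have hmeas : AEMeasurable (fun p : Plane × Plane => chordLength S p.1 p.2 / ‖p.1 - p.2‖ₑ)
      (P.map fun ω => (X ω, Y ω)) :=
    ⟨_, measurable_measure_prodMk_left (measurable_lineMap_uncurry hS₀), hae⟩
  have hint : ∫⁻ ω, chordLength S (X ω) (Y ω) / ‖X ω - Y ω‖ₑ ∂P =
      3 * ((∫⁻ t in Ioo 0 1, collinearMass S₀ t) / (volume S₀ * volume S₀)) := by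
    rw [← lintegral_map' hmeas (hXm.prodMk hYm), lintegral_congr_ae hae, hlaw,
      lintegral_smul_measure, lintegral_smul_measure, lintegral_volume_lineMap_mem hS₀,
      lintegral_collinearMass hS₀, div_eq_mul_inv,
      ENNReal.mul_inv (Or.inl hS_pos.ne') (Or.inl hS_fin.ne), smul_eq_mul, smul_eq_mul]
    ring
  have hm0 : volume S₀ * volume S₀ ≠ 0 := mul_ne_zero hS_pos.ne' hS_pos.ne'
  have hmt : volume S₀ * volume S₀ ≠ ⊤ := ENNReal.mul_ne_top hS_fin.ne hS_fin.ne
  refine ⟨hmeas.comp_aemeasurable (hXm.prodMk hYm), ?_, ?_⟩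
  · rw [hint]
    exact mul_le_of_le_one_right' (ENNReal.div_le_of_le_mul
      ((setLIntegral_collinearMass_Ioo_le S₀).trans_eq (one_mul _).symm))
  · rw [hint, ← ENNReal.div_eq_one_iff hm0 hmt]
    nth_rw 2 [← mul_one (3 : ENNReal)]
    exact ENNReal.mul_right_inj (by norm_num) (by norm_num)
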